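/- Let $A$ be a unital (complex) $C^*$-algebra, $B$ a unital complex Banach algebra, and $T\colon A\to B$ a unital surjective spectral isometry, that is, a surjective linear map with $T1_A=1_B$ and $r(Ta)=r(a)$ for every $a\in A$, where $r$ denotes the spectral radius. The following conditions are equivalent: (a) $T$ is a Jordan isomorphism, i.e. $T$ is bijective and $T(ab+ba)=(Ta)(Tb)+(Tb)(Ta)$ for all $a,b\in A$; (b) $T(A_0)$ is a subalgebra of $B$ for every commutative subalgebra $A_0$ of $A$ containing $1_A$ (not assumed to be closed); (c) $T(\{a\}^{cc})$ is a subalgebra of $B$ for every self-adjoint $a\in A$, where $\{a\}^{cc}$ is the bicommutant of $a$ in $A$, i.e. the set of all elements of $A$ that commute with every element of $A$ commuting with $a$; (d) $T(C^*(a))$ is a subalgebra of $B$ for every self-adjoint $a\in A$, where $C^*(a)$ is the unital $C^*$-subalgebra of $A$ generated by $a$, i.e. the smallest norm-closed $*$-subalgebra of $A$ containing $a$ and $1_A$. -/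

import Mathlib

/-- A spectral isometry between complex algebras: a linear map preserving the spectral radius
of every element. -/
def IsSpectralIsometry {A B : Type*} [Ring A] [Algebra ℂ A] [Ring B] [Algebra ℂ B]
    (T : A →ₗ[ℂ] B) : Prop :=
  ∀ a : A, spectralRadius ℂ (T a) = spectralRadius ℂ a

/-- A Jordan isomorphism: a bijective linear map with `T (ab + ba) = (T a)(T b) + (T b)(T a)`. -/
structure IsJordanIsomorphism {A B : Type*} [Ring A] [Algebra ℂ A] [Ring B] [Algebra ℂ B]
    (T : A →ₗ[ℂ] B) : Prop where
  bijective : Function.Bijective T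
  map_jordan : ∀ a b : A, T (a * b + b * a) = T a * T b + T b * T a

/-- The bicommutant `{a}ᶜᶜ` of an element `a`, taken in the algebra `A`. -/
def bicommutant {A : Type*} [Ring A] [Algebra ℂ A] (a : A) : Subalgebra ℂ A :=
  Subalgebra.centralizer ℂ ((Subalgebra.centralizer ℂ ({a} : Set A) : Subalgebra ℂ A) : Set A)

/-- A subset of a complex algebra is a subalgebra: it is a linear subspace closed under
multiplication. (It is not required to contain the unit; the sets to which this is applied
below do contain it.) -/
def IsSubalgebra {B : Type*} [Ring B] [Algebra ℂ B] (S : Set B) : Prop :=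
  ∃ B₀ : NonUnitalSubalgebra ℂ B, (B₀ : Set B) = S

/-!
Let `r` be the spectral radius and `T : A → B` a unital surjective spectral isometry.

*Global facts.* If `T a = 0`, or if `T a` lies in the separating space of `T`, then adding `a` to a
quasinilpotent element leaves it quasinilpotent. In a C⋆-algebra this forces `a = 0`
(`eq_zero_of_forall_spectralRadius_add`), because `a ± star a` are normal and so are determined by
their spectral radius. Hence `T` is injective and continuous. The estimate for the separating space
is Ransford's three circles inequality `spectralRadius_add_sq_le`.

*From subalgebras to squares.* Let `S` be the bicommutant of, or the C⋆-algebra generated by, a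
self-adjoint `a`. It is a commutative C⋆-algebra, so `‖x‖ = r x = r (T x)` on `S`, and if `T '' S` is
a subalgebra, then it is a closed one whose norm is equivalent to `r`. By Liouville's theorem such a
Banach algebra is commutative (`commute_of_nnnorm_le_spectralRadius`, due to Hirschfeld and
Żelazko). A unital map that does not increase `r` preserves nonnegativity of spectra
(`spectrum_nonneg_map`), because a segment is an intersection of discs; this yields a Schwarz
inequality at every character. Applied both to `T` on `S` and to its inverse, the Schwarz inequality
gives `T (a ^ 2) = (T a) ^ 2` (`spectralRadius_map_sq_sub_sq`). Since this holds for all self-adjoint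
`a`, linearization shows that `T` is a Jordan isomorphism.

*From Jordan isomorphisms to subalgebras.* Double commutators are Jordan polynomials, so if `a` and
`b` commute, then the commutator of `T a` and `T b` is central. It squares to zero by a
computation, and pulling it back to the C⋆-algebra `A` shows that it vanishes. So `T` is
multiplicative on commutative subalgebras (`IsJordanIsomorphism.map_mul_of_commute`).
-/

/-! ### The spectral radius in Banach algebras -/

section Gelfand

variable {B : Type*} [NormedRing B] [NormedAlgebra ℂ B] [CompleteSpace B]

/-- Unlike `spectrum.spectralRadius_le_nnnorm`, this needs no `NormOneClass`: by Gelfand's formula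
only the norms of positive powers matter. -/
theorem spectralRadius_le_nnnorm_of_complete (b : B) : spectralRadius ℂ b ≤ ‖b‖₊ := by
  refine le_of_tendsto (spectrum.pow_nnnorm_pow_one_div_tendsto_nhds_spectralRadius b) ?_
  filter_upwards [Filter.eventually_gt_atTop 0] with n hn
  calc ((‖b ^ n‖₊ : ENNReal)) ^ (1 / n : ℝ) ≤ ((‖b‖₊ : ENNReal) ^ n) ^ (1 / n : ℝ) := by
        gcongr
        exact_mod_cast nnnorm_pow_le' b hn
    _ = ‖b‖₊ := by
        rw [one_div]
        exact ENNReal.pow_rpow_inv_natCast hn.ne' _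

theorem exists_norm_pow_lt_of_spectralRadius_lt {b : B} {M : ℝ} (hM : 0 < M)
    (h : spectralRadius ℂ b < ENNReal.ofReal M) : ∃ k : ℕ, 0 < k ∧ ‖b ^ k‖ < M ^ k := by
  have h1 := (spectrum.pow_norm_pow_one_div_tendsto_nhds_spectralRadius b).eventually_lt_const h
  obtain ⟨k, hk, hk0⟩ := (h1.and (Filter.eventually_gt_atTop 0)).exists
  refine ⟨k, hk0, ?_⟩
  have h2 : ‖b ^ k‖ ^ (1 / k : ℝ) < M := (ENNReal.ofReal_lt_ofReal_iff hM).1 hk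
  have h3 := pow_lt_pow_left₀ h2 (by positivity) hk0.ne'
  rwa [one_div, Real.rpow_inv_natCast_pow (norm_nonneg _) hk0.ne'] at h3

theorem spectralRadius_pow_le_of_norm_pow_le {b : B} {k : ℕ} (hk : 0 < k) {M : ℝ}
    (h : ‖b ^ k‖ ≤ M) : spectralRadius ℂ b ^ k ≤ ENNReal.ofReal M := by
  refine (spectrum.spectralRadius_pow_le b k hk.ne').trans
    ((spectralRadius_le_nnnorm_of_complete _).trans ?_)
  rw [← enorm_eq_nnnorm, ← ofReal_norm]
  exact ENNReal.ofReal_le_ofReal h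

/-- Upper semicontinuity of the spectral radius. -/
theorem eventually_spectralRadius_lt {b : B} {M : ℝ} (hM : 0 < M)
    (h : spectralRadius ℂ b < ENNReal.ofReal M) :
    ∀ᶠ c in nhds b, spectralRadius ℂ c < ENNReal.ofReal M := by
  obtain ⟨k, hk0, hk⟩ := exists_norm_pow_lt_of_spectralRadius_lt hM h
  have : Continuous fun c : B ↦ ‖c ^ k‖ := by fun_prop
  filter_upwards [this.continuousAt.eventually_lt_const hk] with c hc
  have h1 := spectralRadius_pow_le_of_norm_pow_le hk0 (le_refl ‖c ^ k‖)
  have h2 : spectralRadius ℂ c ^ k < ENNReal.ofReal M ^ k := by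
    rw [← ENNReal.ofReal_pow hM.le]
    exact h1.trans_lt ((ENNReal.ofReal_lt_ofReal_iff (by positivity)).2 hc)
  exact (ENNReal.pow_lt_pow_left_iff hk0.ne').1 h2

/-- A Dini-type statement: if the spectral radius is below `M` along a compact family, then a
single power witnesses this for the whole family. -/
theorem exists_forall_norm_pow_le {X : Type*} [TopologicalSpace X] {s : Set X} (hs : IsCompact s)
    {q : X → B} (hq : Continuous q) {M : ℝ} (hM : 0 < M)
    (h : ∀ x ∈ s, spectralRadius ℂ (q x) < ENNReal.ofReal M) :
    ∃ k : ℕ, 0 < k ∧ ∀ x ∈ s, ‖q x ^ k‖ ≤ M ^ k := by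
  have key : ∀ {b : B} {k m : ℕ}, 0 < m → ‖b ^ k‖ ≤ M ^ k → ‖b ^ (k * m)‖ ≤ M ^ (k * m) := by
    intro b k m hm hb
    rw [pow_mul, pow_mul]
    exact (norm_pow_le' _ hm).trans (pow_le_pow_left₀ (norm_nonneg _) hb m)
  refine hs.induction_on (p := fun t ↦ ∃ k : ℕ, 0 < k ∧ ∀ x ∈ t, ‖q x ^ k‖ ≤ M ^ k)
    ⟨1, one_pos, by simp⟩ ?_ ?_ ?_
  · rintro t u htu ⟨k, hk, hu⟩
    exact ⟨k, hk, fun x hx ↦ hu x (htu hx)⟩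
  · rintro t u ⟨k, hk, ht⟩ ⟨m, hm, hu⟩
    refine ⟨k * m, Nat.mul_pos hk hm, ?_⟩
    rintro x (hx | hx)
    · exact key hm (ht x hx)
    · rw [mul_comm]
      exact key hk (hu x hx)
  · intro x hx
    obtain ⟨k, hk, hlt⟩ := exists_norm_pow_lt_of_spectralRadius_lt hM (h x hx)
    have : Continuous fun c : X ↦ ‖q c ^ k‖ := by fun_prop
    exact ⟨_, mem_nhdsWithin_of_mem_nhds (this.continuousAt.eventually_lt_const hlt), k, hk,
      fun y hy ↦ le_of_lt hy⟩

/-- Ransford's inequality: a three circles theorem for the spectral radius of a pencil `u + z v`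
on the circles of radius `R⁻¹`, `1` and `R`. -/
theorem spectralRadius_add_sq_le {u v : B} {R M₁ M₂ : ℝ} (hR : 1 < R) (hM₁ : 0 < M₁)
    (hM₂ : 0 < M₂)
    (h₁ : ∀ z : ℂ, ‖z‖ = R → spectralRadius ℂ (u + z • v) < ENNReal.ofReal M₁)
    (h₂ : ∀ z : ℂ, ‖z‖ = R⁻¹ → spectralRadius ℂ (u + z • v) < ENNReal.ofReal M₂) :
    spectralRadius ℂ (u + v) ^ 2 ≤ ENNReal.ofReal (M₁ * M₂) := by
  have hR0 : 0 < R := by linarith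
  have hRi : R⁻¹ < 1 := inv_lt_one_of_one_lt₀ hR
  set q : ℂ → B := fun z ↦ u + z • v with hq
  have hqc : Continuous q := by fun_prop
  obtain ⟨k, hk, hk'⟩ := exists_forall_norm_pow_le (isCompact_sphere (0 : ℂ) R) hqc hM₁
    (fun z hz ↦ h₁ z (by simpa using hz))
  obtain ⟨m, hm, hm'⟩ := exists_forall_norm_pow_le (isCompact_sphere (0 : ℂ) R⁻¹) hqc hM₂
    (fun z hz ↦ h₂ z (by simpa using hz))
  set N := k * m with hN
  have hN0 : 0 < N := Nat.mul_pos hk hm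
  have b₁ : ∀ z : ℂ, ‖z‖ = R → ‖q z ^ N‖ ≤ M₁ ^ N := by
    intro z hz
    rw [hN, pow_mul, pow_mul]
    exact (norm_pow_le' _ hm).trans (pow_le_pow_left₀ (norm_nonneg _) (hk' z (by simpa using hz)) m)
  have b₂ : ∀ z : ℂ, ‖z‖ = R⁻¹ → ‖q z ^ N‖ ≤ M₂ ^ N := by
    intro z hz
    rw [hN, mul_comm k m, pow_mul, pow_mul]
    exact (norm_pow_le' _ hk).trans (pow_le_pow_left₀ (norm_nonneg _) (hm' z (by simpa using hz)) k)
  -- The maximum principle is applied to `q z ^ N * q z⁻¹ ^ N`: since `z ↦ z⁻¹` swaps the two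
  -- boundary circles of the annulus, the same bound holds on both.
  set U : Set ℂ := {z | R⁻¹ < ‖z‖ ∧ ‖z‖ < R} with hU
  have hUo : IsOpen U :=
    (isOpen_lt continuous_const continuous_norm).inter (isOpen_lt continuous_norm continuous_const)
  have hcl : closure U ⊆ {z : ℂ | R⁻¹ ≤ ‖z‖ ∧ ‖z‖ ≤ R} := by
    refine closure_minimal (fun z hz ↦ ⟨hz.1.le, hz.2.le⟩) ?_
    exact (isClosed_le continuous_const continuous_norm).inter
      (isClosed_le continuous_norm continuous_const)
  have hUb : Bornology.IsBounded U :=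
    (Metric.isBounded_closedBall (x := (0 : ℂ)) (r := R)).subset
      (fun z hz ↦ by simpa using hz.2.le)
  have hdiff : DiffContOnCl ℂ (fun z : ℂ ↦ q z ^ N * q z⁻¹ ^ N) U := by
    refine DifferentiableOn.diffContOnCl fun z hz ↦ ?_
    have hz0 : z ≠ 0 := by
      rintro rfl
      have := (hcl hz).1
      rw [norm_zero] at this
      exact absurd this (not_le.2 (inv_pos.2 hR0))
    have d1 : DifferentiableAt ℂ q z := by
      simp only [hq]; fun_prop
    have d2 : DifferentiableAt ℂ (fun w : ℂ ↦ q w⁻¹) z := by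
      have := differentiableAt_inv (𝕜 := ℂ) hz0
      simp only [hq]; fun_prop
    exact ((d1.pow N).mul (d2.pow N)).differentiableWithinAt
  have hone : (1 : ℂ) ∈ closure U := subset_closure ⟨by simpa using hRi, by simpa using hR⟩
  have hmax := Complex.norm_le_of_forall_mem_frontier_norm_le hUb hdiff
    (C := M₁ ^ N * M₂ ^ N) ?_ hone
  · have e1 : q 1 ^ N * q 1⁻¹ ^ N = ((u + v) ^ 2) ^ N := by
      simp [hq, ← pow_add, ← pow_mul, two_mul]
    rw [e1, ← mul_pow] at hmax
    have h3 : ENNReal.ofReal ((M₁ * M₂) ^ N) = ENNReal.ofReal (M₁ * M₂) ^ N :=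
      ENNReal.ofReal_pow (by positivity) N
    have h5 := (spectrum.spectralRadius_pow_le (𝕜 := ℂ) (u + v) 2 two_ne_zero)
    have h4 := spectralRadius_pow_le_of_norm_pow_le hN0 hmax
    rw [h3] at h4
    exact h5.trans ((ENNReal.pow_le_pow_left_iff hN0.ne').1 h4)
  · intro z hz
    rw [hUo.frontier_eq] at hz
    have hz1 := hcl hz.1
    have hz2 : ‖z‖ = R ∨ ‖z‖ = R⁻¹ := by
      by_contra! hcon
      exact hz.2 ⟨lt_of_le_of_ne hz1.1 hcon.2.symm, lt_of_le_of_ne hz1.2 hcon.1⟩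
    refine (norm_mul_le _ _).trans ?_
    rcases hz2 with h | h
    · exact mul_le_mul (b₁ z h) (b₂ _ (by rw [norm_inv, h])) (norm_nonneg _) (by positivity)
    · rw [mul_comm (M₁ ^ N)]
      exact mul_le_mul (b₂ z h) (b₁ _ (by rw [norm_inv, h, inv_inv])) (norm_nonneg _)
        (by positivity)

/-- If the norm is dominated by the spectral radius, the Banach algebra is commutative: the entire
function `exp (z x) y exp (-z x)` has constant spectral radius, hence is bounded, hence is
constant, and its derivative at `0` is the commutator of `x` and `y`. -/
theorem commute_of_nnnorm_le_spectralRadius (K : NNReal)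
    (hK : ∀ b : B, (‖b‖₊ : ENNReal) ≤ K * spectralRadius ℂ b) (x y : B) : x * y = y * x := by
  let _ : NormedAlgebra ℚ B := NormedAlgebra.restrictScalars ℚ ℂ B
  set f : ℂ → B := fun z ↦ NormedSpace.exp (z • x) * y * NormedSpace.exp (z • (-x)) with hf
  have hd : ∀ z : ℂ, ∀ w : B, HasDerivAt (fun z : ℂ ↦ NormedSpace.exp (z • w))
      (NormedSpace.exp (z • w) * w) z := fun z w ↦ hasDerivAt_exp_smul_const w z
  have hdf : ∀ z, HasDerivAt f _ z := fun z ↦ ((hd z x).mul_const y).mul (hd z (-x))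
  have hinv : ∀ z : ℂ, NormedSpace.exp (z • x) * NormedSpace.exp (z • (-x)) = 1 ∧
      NormedSpace.exp (z • (-x)) * NormedSpace.exp (z • x) = 1 := by
    intro z
    have hc : Commute (z • x) (z • (-x)) := by
      simp [Commute, SemiconjBy]
    constructor
    · rw [← NormedSpace.exp_add_of_commute hc]; simp
    · rw [← NormedSpace.exp_add_of_commute hc.symm]; simp
  have hr : ∀ z, spectralRadius ℂ (f z) = spectralRadius ℂ y := by
    intro z
    let e : Bˣ := ⟨NormedSpace.exp (z • x), NormedSpace.exp (z • (-x)), (hinv z).1, (hinv z).2⟩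
    have : spectrum ℂ (f z) = spectrum ℂ y := spectrum.units_conjugate (u := e)
    simp only [spectralRadius, this]
  have hb : Bornology.IsBounded (Set.range f) := by
    refine (Metric.isBounded_closedBall (x := (0 : B)) (r := K * ‖y‖)).subset ?_
    rintro _ ⟨z, rfl⟩
    have h1 := (hK (f z)).trans (by rw [hr z])
    have h2 : (‖f z‖₊ : ENNReal) ≤ K * ‖y‖₊ :=
      h1.trans (mul_le_mul_right (spectralRadius_le_nnnorm_of_complete y) _)
    rw [mem_closedBall_zero_iff]
    exact_mod_cast h2
  have hconst : f = fun _ ↦ f 0 :=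
    funext fun z ↦ Differentiable.apply_eq_apply_of_bounded
      (fun z ↦ (hdf z).differentiableAt) hb z 0
  have h0 := hdf 0
  rw [hconst] at h0
  have := h0.unique (hasDerivAt_const (0 : ℂ) (f 0))
  simp only [zero_smul, NormedSpace.exp_zero, one_mul, mul_one, mul_neg] at this
  rwa [← sub_eq_add_neg, sub_eq_zero] at this

end Gelfand

/-! ### Automatic continuity and injectivity -/

section Continuity

variable {A B : Type*} [CStarAlgebra A]

theorem spectralRadius_star (a : A) : spectralRadius ℂ (star a) = spectralRadius ℂ a := by
  refine tendsto_nhds_unique (spectrum.pow_norm_pow_one_div_tendsto_nhds_spectralRadius (star a)) ?_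
  simpa only [← star_pow, norm_star] using
    spectrum.pow_norm_pow_one_div_tendsto_nhds_spectralRadius a

/-- An element of a C⋆-algebra whose addition keeps quasinilpotent elements quasinilpotent is zero:
it suffices to add it to `0` and to `± star a`. This replaces the description of the radical by
the spectral radius. -/
theorem eq_zero_of_forall_spectralRadius_add {a : A}
    (h : ∀ c : A, spectralRadius ℂ c = 0 → spectralRadius ℂ (c + a) = 0) : a = 0 := by
  have ha : spectralRadius ℂ a = 0 := by
    simpa using h 0 spectrum.spectralRadius_zero
  have hs : spectralRadius ℂ (star a) = 0 := by rw [spectralRadius_star, ha]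
  have hn : spectralRadius ℂ (-star a) = 0 := by
    refine le_antisymm ?_ bot_le
    rw [← hs]
    refine iSup₂_le fun k hk ↦ ?_
    rw [← spectrum.neg_eq, Set.mem_neg] at hk
    simpa [spectralRadius] using
      le_iSup₂ (f := fun (k : ℂ) (_ : k ∈ spectrum ℂ (star a)) ↦ (‖k‖₊ : ENNReal)) _ hk
  have h1 : star a + a = 0 := by
    have h2 := h _ hs
    have hsa : IsSelfAdjoint (star a + a) := IsSelfAdjoint.star_add_self a
    rw [hsa.spectralRadius_eq_nnnorm] at h2
    simpa using h2
  have h3 : -star a + a = 0 := by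
    have h2 := h _ hn
    have hsa : IsStarNormal (-star a + a) := by
      constructor
      simp only [star_add, star_neg, star_star]
      have : -a + star a = -(-star a + a) := by abel
      rw [this]
      exact (Commute.refl _).neg_left
    rw [IsStarNormal.spectralRadius_eq_nnnorm] at h2
    simpa using h2
  have h4 : (2 : ℂ) • a = 0 := by
    rw [two_smul]
    calc a + a = (star a + a) + (-star a + a) := by abel
      _ = 0 := by rw [h1, h3, add_zero]
  exact (smul_eq_zero.1 h4).resolve_left two_ne_zero

theorem IsSpectralIsometry.injective [Ring B] [Algebra ℂ B] {T : A →ₗ[ℂ] B}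
    (hT : IsSpectralIsometry T) :
    Function.Injective T := by
  refine (injective_iff_map_eq_zero T).2 fun a ha ↦ eq_zero_of_forall_spectralRadius_add ?_
  intro c hc
  rw [← hT, map_add, ha, add_zero, hT, hc]

/-- A surjective spectral isometry is continuous. An element `T a` of its separating space
satisfies `r (c + a) = 0` whenever `r c = 0`, by Ransford's inequality applied to the pencils
`z (T x) + T c + (T a - T x)` with `x` small and `T x` close to `T a`. -/
theorem IsSpectralIsometry.continuous [NormedRing B] [NormedAlgebra ℂ B] [CompleteSpace B]
    {T : A →ₗ[ℂ] B} (hT : IsSpectralIsometry T)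
    (hT_surj : Function.Surjective T) : Continuous T := by
  refine LinearMap.continuous_of_seq_closed_graph (g := T) ?_
  intro u x y hu hTu
  obtain ⟨a, ha⟩ := hT_surj (y - T x)
  suffices a = 0 by
    rw [this, map_zero] at ha
    exact sub_eq_zero.1 ha.symm
  have hv : Filter.Tendsto (fun n ↦ u n - x) Filter.atTop (nhds 0) := by
    simpa using hu.sub_const x
  have hTv : Filter.Tendsto (fun n ↦ T (u n - x)) Filter.atTop (nhds (T a)) := by
    simpa [ha] using hTu.sub_const (T x)
  refine eq_zero_of_forall_spectralRadius_add fun c hc ↦ ?_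
  have hTc : spectralRadius ℂ (T c) = 0 := by rw [hT, hc]
  set M : ℝ := ‖c + a‖ + 1 with hM
  have hM0 : 0 < M := by positivity
  have key : ∀ ε : ℝ, 0 < ε → spectralRadius ℂ (c + a) ^ 2 ≤ ENNReal.ofReal (M * ε) := by
    intro ε hε
    obtain ⟨δ, hδ, hδ'⟩ := Metric.eventually_nhds_iff.1
      (eventually_spectralRadius_lt (b := T c) hε (by rw [hTc]; simpa using hε))
    -- `R` is so large that `‖z • T w‖ ≤ δ / 2` for `‖z‖ = R⁻¹` as soon as `‖T w‖ < ‖T a‖ + 1`.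
    set R : ℝ := 2 * (‖T a‖ + 1) / δ + 2 with hR
    have hR1 : 1 < R := by
      have : 0 ≤ 2 * (‖T a‖ + 1) / δ := by positivity
      linarith
    have hR0 : 0 < R := by linarith
    have e1 : ∀ᶠ n in Filter.atTop, (R + 1) * ‖u n - x‖ < 1 := by
      have := (hv.norm.const_mul (R + 1))
      rw [norm_zero, mul_zero] at this
      exact this.eventually_lt_const one_pos
    have e2 : ∀ᶠ n in Filter.atTop, ‖T (u n - x) - T a‖ < min 1 (δ / 2) := by
      have := (hTv.sub_const (T a)).norm
      rw [sub_self, norm_zero] at this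
      exact this.eventually_lt_const (by positivity)
    obtain ⟨n, h1, h2⟩ := (e1.and e2).exists
    set w := u n - x
    have h3 := h2.trans_le (min_le_left _ _)
    have h4 := h2.trans_le (min_le_right _ _)
    have h5 : ‖T w‖ < ‖T a‖ + 1 := by
      calc ‖T w‖ = ‖T a + (T w - T a)‖ := by congr 1; abel
        _ ≤ ‖T a‖ + ‖T w - T a‖ := norm_add_le _ _
        _ < _ := by linarith
    have := spectralRadius_add_sq_le (u := T (c + a - w)) (v := T w) hR1 hM0 hε ?_ ?_
    · rwa [← map_add, sub_add_cancel, hT] at this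
    · intro z hz
      rw [← map_smul, ← map_add, hT]
      refine (spectralRadius_le_nnnorm_of_complete _).trans_lt ?_
      rw [← enorm_eq_nnnorm, ← ofReal_norm, ENNReal.ofReal_lt_ofReal_iff hM0]
      calc ‖c + a - w + z • w‖ ≤ ‖c + a‖ + ‖w‖ + ‖z • w‖ :=
            (norm_add_le _ _).trans (add_le_add_left (norm_sub_le _ _) _)
        _ = ‖c + a‖ + (R + 1) * ‖w‖ := by rw [norm_smul, hz]; ring
        _ < M := by linarith
    · intro z hz
      apply hδ'
      rw [dist_eq_norm]
      have h6 : R⁻¹ * ‖T w‖ ≤ δ / 2 := by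
        rw [inv_mul_le_iff₀ hR0]
        have : (‖T a‖ + 1) = (2 * (‖T a‖ + 1) / δ) * (δ / 2) := by field_simp
        have h7 : R * (δ / 2) = (2 * (‖T a‖ + 1) / δ) * (δ / 2) + δ := by rw [hR]; ring
        linarith
      calc ‖T (c + a - w) + z • T w - T c‖ = ‖z • T w - (T w - T a)‖ := by
            congr 1; rw [map_sub, map_add]; abel
        _ ≤ ‖z • T w‖ + ‖T w - T a‖ := norm_sub_le _ _
        _ = R⁻¹ * ‖T w‖ + ‖T w - T a‖ := by rw [norm_smul, hz]
        _ < δ := by linarith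
  have hz : spectralRadius ℂ (c + a) ^ 2 ≤ 0 := by
    have hcont : Continuous fun ε : ℝ ↦ ENNReal.ofReal (M * ε) :=
      ENNReal.continuous_ofReal.comp (continuous_const_mul M)
    have ht : Filter.Tendsto (fun ε : ℝ ↦ ENNReal.ofReal (M * ε)) (nhdsWithin 0 (Set.Ioi 0))
        (nhds 0) := by
      simpa using (hcont.tendsto 0).mono_left nhdsWithin_le_nhds
    exact ge_of_tendsto ht (Filter.eventually_of_mem self_mem_nhdsWithin key)
  simpa using hz

end Continuity

/-! ### Unital spectral isometries between commutative Banach algebras -/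

section Commutative

open WeakDual

/-- A unital linear map that does not increase the spectral radius preserves nonnegativity of the
spectrum: a spectrum in `[0, ρ]` lies in every disc about `ρ / 2 + i s` with `0` and `ρ` on its
boundary, and these discs intersect in `[0, ρ]`. -/
theorem spectrum_nonneg_map {C D : Type*} [NormedRing C] [NormedAlgebra ℂ C] [CompleteSpace C]
    [Ring D] [Algebra ℂ D] {f : C →ₗ[ℂ] D} (hf_one : f 1 = 1)
    (hf : ∀ c, spectralRadius ℂ (f c) ≤ spectralRadius ℂ c) {c : C}
    (hc : ∀ z ∈ spectrum ℂ c, 0 ≤ z.re ∧ z.im = 0) :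
    ∀ w ∈ spectrum ℂ (f c), 0 ≤ w.re ∧ w.im = 0 := by
  intro w hw
  set ρ : ℝ := ‖c‖ * ‖(1 : C)‖
  have hρ : ∀ z ∈ spectrum ℂ c, z.re ≤ ρ := fun z hz ↦
    (Complex.re_le_norm z).trans (spectrum.norm_le_norm_mul_of_mem hz)
  -- `l - w` lies in the spectrum of `f (l - c)`, and `l - c` has spectral radius at most `‖l‖`.
  have key : ∀ s : ℝ, (ρ / 2 - w.re) ^ 2 + (s - w.im) ^ 2 ≤ (ρ / 2) ^ 2 + s ^ 2 := by
    intro s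
    set l : ℂ := ⟨ρ / 2, s⟩
    have hl : f (algebraMap ℂ C l - c) = algebraMap ℂ D l - f c := by
      rw [map_sub, Algebra.algebraMap_eq_smul_one, map_smul, hf_one, Algebra.algebraMap_eq_smul_one]
    have h1 : l - w ∈ spectrum ℂ (f (algebraMap ℂ C l - c)) := by
      rw [hl, ← spectrum.singleton_sub_eq]
      exact Set.sub_mem_sub rfl hw
    have h2 : spectralRadius ℂ (algebraMap ℂ C l - c)
        ≤ ENNReal.ofReal √((ρ / 2) ^ 2 + s ^ 2) := by
      refine iSup₂_le fun k hk ↦ ?_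
      rw [← spectrum.singleton_sub_eq] at hk
      obtain ⟨_, rfl, z, hz, rfl⟩ := hk
      rw [← enorm_eq_nnnorm, ← ofReal_norm]
      refine ENNReal.ofReal_le_ofReal ?_
      rw [Complex.norm_def, Complex.normSq_apply]
      refine Real.sqrt_le_sqrt ?_
      obtain ⟨h3, h4⟩ := hc z hz
      have h5 := hρ z hz
      simp only [l, Complex.sub_re, Complex.sub_im, h4]
      nlinarith
    have h3 : (‖l - w‖₊ : ENNReal) ≤ ENNReal.ofReal √((ρ / 2) ^ 2 + s ^ 2) :=
      (le_iSup₂ (f := fun (k : ℂ) (_ : k ∈ spectrum ℂ (f (algebraMap ℂ C l - c))) ↦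
        (‖k‖₊ : ENNReal)) _ h1).trans ((hf _).trans h2)
    rw [← enorm_eq_nnnorm, ← ofReal_norm, ENNReal.ofReal_le_ofReal_iff (Real.sqrt_nonneg _),
      Complex.norm_def, Complex.normSq_apply] at h3
    have h4 := (Real.sqrt_le_sqrt_iff (by positivity)).1 h3
    simp only [l, Complex.sub_re, Complex.sub_im] at h4
    nlinarith
  have him : w.im = 0 := by
    by_contra hne
    -- For this `s` the term `-2 * s * w.im` equals `2 * (ρ * |w.re| + 1) > ρ * w.re`.
    have h := key (-(ρ * |w.re| + 1) / w.im)
    have h1 : -(ρ * |w.re| + 1) / w.im * w.im = -(ρ * |w.re| + 1) := by field_simp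
    have hρ0 : 0 ≤ ρ := by positivity
    nlinarith [mul_le_mul_of_nonneg_left (le_abs_self w.re) hρ0, mul_nonneg hρ0 (abs_nonneg w.re),
      sq_nonneg w.re, sq_nonneg w.im]
  refine ⟨?_, him⟩
  have h := key 0
  rw [him] at h
  have hρ0 : 0 ≤ ρ := by positivity
  by_contra hneg
  rw [not_le] at hneg
  nlinarith [mul_nonneg hρ0 (neg_pos.2 hneg).le, mul_pos_of_neg_of_neg hneg hneg]

variable {C D : Type*} [NormedCommRing C] [NormedAlgebra ℂ C] [CompleteSpace C]
  [NormedCommRing D] [NormedAlgebra ℂ D] [CompleteSpace D]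

/-- A Kadison-Schwarz inequality, evaluated at a character. It follows from the positivity of
`f ((h - t) ^ 2)` for all real `t`. -/
theorem character_map_sq_sub_sq_nonneg {f : C →ₗ[ℂ] D} (hf_one : f 1 = 1)
    (hf : ∀ c, spectralRadius ℂ (f c) ≤ spectralRadius ℂ c) {h : C}
    (hh : ∀ z ∈ spectrum ℂ h, z.im = 0) (ψ : characterSpace ℂ D) :
    (ψ (f h)).im = 0 ∧ 0 ≤ (ψ (f (h ^ 2)) - ψ (f h) ^ 2).re ∧
      (ψ (f (h ^ 2)) - ψ (f h) ^ 2).im = 0 := by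
  have key : ∀ t : ℝ, 0 ≤ (ψ (f (h ^ 2)) - 2 * t * ψ (f h) + t ^ 2).re ∧
      (ψ (f (h ^ 2)) - 2 * t * ψ (f h) + t ^ 2).im = 0 := by
    intro t
    have h1 : f ((h - (t : ℂ) • 1) ^ 2) =
        f (h ^ 2) - (2 * t : ℂ) • f h + ((t : ℂ) ^ 2) • 1 := by
      have : (h - (t : ℂ) • 1) ^ 2 = h ^ 2 - (2 * t : ℂ) • h + ((t : ℂ) ^ 2) • 1 := by
        simp only [Algebra.smul_def, map_mul, map_pow, map_ofNat]; ring
      rw [this, map_add, map_sub, map_smul, map_smul, hf_one]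
    have h2 : ∀ z ∈ spectrum ℂ ((h - (t : ℂ) • 1) ^ 2), 0 ≤ z.re ∧ z.im = 0 := by
      intro z hz
      obtain ⟨φ, rfl⟩ := CharacterSpace.mem_spectrum_iff_exists.1 hz
      have h3 := hh (φ h) (CharacterSpace.mem_spectrum_iff_exists.2 ⟨φ, rfl⟩)
      have h4 : φ ((h - (t : ℂ) • 1) ^ 2) = (φ h - t) ^ 2 := by
        rw [map_pow, map_sub, map_smul, map_one, smul_eq_mul, mul_one]
      rw [h4, sq]
      simp only [Complex.mul_re, Complex.mul_im, Complex.sub_re, Complex.sub_im, h3,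
        Complex.ofReal_re, Complex.ofReal_im]
      constructor
      · nlinarith [mul_self_nonneg ((φ h).re - t)]
      · ring
    have h3 := spectrum_nonneg_map hf_one hf h2 (ψ (f ((h - (t : ℂ) • 1) ^ 2)))
      (CharacterSpace.mem_spectrum_iff_exists.2 ⟨ψ, rfl⟩)
    have h4 : ψ (f ((h - (t : ℂ) • 1) ^ 2)) = ψ (f (h ^ 2)) - 2 * t * ψ (f h) + t ^ 2 := by
      rw [h1, map_add, map_sub, map_smul, map_smul, map_one, smul_eq_mul, smul_eq_mul, mul_one]
    rwa [h4] at h3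
  -- Comparing imaginary parts at `t = 0` and `t = 1` shows that `ψ (f h)` is real.
  have k0 := (key 0).2
  have k1 := (key 1).2
  simp at k0 k1
  have him : (ψ (f h)).im = 0 := by
    have := k1; rw [k0] at this; simpa using this
  have kt := (key (ψ (f h)).re).1
  refine ⟨him, ?_, ?_⟩
  · simp [sq, him] at kt ⊢
    linarith
  · rw [Complex.sub_im, k0, sq, Complex.mul_im, him]
    ring

/-- A unital spectral isometry between commutative Banach algebras, with inverse `g`, preserves
squares of elements with real spectrum up to quasinilpotents: the Schwarz inequality holds for
both `f` and `g`. -/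
theorem spectralRadius_map_sq_sub_sq {f : C →ₗ[ℂ] D} {g : D →ₗ[ℂ] C} (hf_one : f 1 = 1)
    (hf : ∀ c, spectralRadius ℂ (f c) = spectralRadius ℂ c) (hgf : ∀ c, g (f c) = c)
    (hfg : ∀ d, f (g d) = d) {h : C} (hh : ∀ z ∈ spectrum ℂ h, z.im = 0) :
    spectralRadius ℂ (f (h ^ 2) - f h ^ 2) = 0 := by
  have hg_one : g 1 = 1 := by rw [← hf_one, hgf]
  have hg : ∀ d, spectralRadius ℂ (g d) ≤ spectralRadius ℂ d := fun d ↦ by rw [← hf, hfg]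
  have hf' : ∀ c, spectralRadius ℂ (f c) ≤ spectralRadius ℂ c := fun c ↦ (hf c).le
  have hfh : ∀ z ∈ spectrum ℂ (f h), z.im = 0 := by
    intro z hz
    obtain ⟨ψ, rfl⟩ := CharacterSpace.mem_spectrum_iff_exists.1 hz
    exact (character_map_sq_sub_sq_nonneg hf_one hf' hh ψ).1
  have h1 : ∀ z ∈ spectrum ℂ (g (f h ^ 2) - h ^ 2), 0 ≤ z.re ∧ z.im = 0 := by
    intro z hz
    obtain ⟨φ, rfl⟩ := CharacterSpace.mem_spectrum_iff_exists.1 hz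
    have := (character_map_sq_sub_sq_nonneg hg_one hg hfh φ).2
    rwa [hgf, ← map_pow φ h 2, ← map_sub φ] at this
  have h2 := spectrum_nonneg_map hf_one hf' h1
  rw [map_sub, hfg] at h2
  refine le_antisymm (iSup₂_le fun z hz ↦ ?_) bot_le
  obtain ⟨ψ, rfl⟩ := CharacterSpace.mem_spectrum_iff_exists.1 hz
  have h3 := (character_map_sq_sub_sq_nonneg hf_one hf' hh ψ).2
  have h4 := h2 (ψ (f h ^ 2 - f (h ^ 2))) (CharacterSpace.mem_spectrum_iff_exists.2 ⟨ψ, rfl⟩)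
  rw [← map_pow ψ (f h) 2, ← map_sub ψ] at h3
  rw [← neg_sub, map_neg] at h4
  have h5 : ψ (f (h ^ 2) - f h ^ 2) = 0 := by
    apply Complex.ext
    · have := h4.1
      rw [Complex.neg_re] at this
      exact le_antisymm (by simpa using this) h3.1
    · exact h3.2
  simp [h5]

end Commutative

/-! ### Squares in commutative C⋆-subalgebras with multiplicatively closed image -/

section Local

variable {A B : Type*} [CStarAlgebra A] [NormedRing B] [NormedAlgebra ℂ B] [CompleteSpace B]

theorem Subalgebra.spectralRadius_coe (D : Subalgebra ℂ B) [CompleteSpace D] (x : D) :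
    spectralRadius ℂ (x : B) = spectralRadius ℂ x := by
  refine tendsto_nhds_unique
    (spectrum.pow_norm_pow_one_div_tendsto_nhds_spectralRadius (x : B)) ?_
  exact spectrum.pow_norm_pow_one_div_tendsto_nhds_spectralRadius x

/-- On a commutative C⋆-subalgebra `S`, a spectral isometry `T` is bounded below, so `T '' S` is a
Banach algebra whose norm is equivalent to the spectral radius. It is therefore commutative and
`T` restricts to a unital spectral isometry between commutative Banach algebras. -/
theorem IsSpectralIsometry.map_mul_self {T : A →ₗ[ℂ] B} (hT : IsSpectralIsometry T)
    (hT_one : T 1 = 1) (hT_cont : Continuous T) (S : StarSubalgebra ℂ A)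
    (hS : IsClosed (S : Set A)) (hcomm : ∀ x ∈ S, ∀ y ∈ S, x * y = y * x)
    (hsub : IsSubalgebra (T '' (S : Set A))) {h : A} (hh : h ∈ S) (hsa : IsSelfAdjoint h) :
    T (h * h) = T h * T h := by
  obtain ⟨D₀, hD₀⟩ := hsub
  have hD₁ : ∀ b, b ∈ D₀ ↔ ∃ x ∈ S, T x = b := fun b ↦ by
    rw [← SetLike.mem_coe, hD₀]; rfl
  let D : Subalgebra ℂ B :=
    { D₀ with
      algebraMap_mem' := fun z ↦ (hD₁ _).2 ⟨algebraMap ℂ A z, S.algebraMap_mem z, by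
        rw [Algebra.algebraMap_eq_smul_one, map_smul, hT_one, Algebra.algebraMap_eq_smul_one]⟩
      one_mem' := (hD₁ _).2 ⟨1, one_mem S, hT_one⟩ }
  have hD : ∀ b, b ∈ D ↔ ∃ x ∈ S, T x = b := hD₁
  have hnorm : ∀ x ∈ S, spectralRadius ℂ (T x) = ‖x‖₊ := by
    intro x hx
    have : IsStarNormal x := ⟨hcomm _ (star_mem hx) _ hx⟩
    rw [hT, IsStarNormal.spectralRadius_eq_nnnorm]
  have hbelow : ∀ x ∈ S, ‖x‖₊ ≤ ‖T x‖₊ := by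
    intro x hx
    have := spectralRadius_le_nnnorm_of_complete (T x)
    rw [hnorm x hx] at this
    exact_mod_cast this
  have : CompleteSpace S := hS.completeSpace_coe
  let f : S →ₗ[ℂ] D :=
    (T.comp S.toSubalgebra.val.toLinearMap).codRestrict (Subalgebra.toSubmodule D)
      fun x ↦ (hD _).2 ⟨x, x.2, rfl⟩
  have hf : ∀ x : S, (f x : B) = T x := fun x ↦ rfl
  have hDclosed : IsClosed (D : Set B) := by
    let Tc : A →L[ℂ] B := ⟨T, hT_cont⟩
    have hanti : AntilipschitzWith 1 (fun x : S ↦ T x) := by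
      refine AntilipschitzWith.of_le_mul_dist fun x y ↦ ?_
      rw [dist_eq_norm, dist_eq_norm, ← map_sub, NNReal.coe_one, one_mul]
      exact_mod_cast hbelow _ (sub_mem x.2 y.2)
    have huc : UniformContinuous (fun x : S ↦ T x) :=
      Tc.uniformContinuous.comp uniformContinuous_subtype_val
    have hr : (D : Set B) = Set.range (fun x : S ↦ T x) := by
      ext b
      rw [SetLike.mem_coe, hD]
      simp
    rw [hr]
    exact hanti.isClosed_range huc
  have : CompleteSpace D := hDclosed.completeSpace_coe
  have hDcomm : ∀ x y : D, x * y = y * x := by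
    let Tc : A →L[ℂ] B := ⟨T, hT_cont⟩
    refine commute_of_nnnorm_le_spectralRadius ‖Tc‖₊ ?_
    rintro ⟨b, hb⟩
    obtain ⟨x, hx, rfl⟩ := (hD b).1 hb
    rw [← Subalgebra.spectralRadius_coe, hnorm x hx]
    exact_mod_cast Tc.le_opNNNorm x
  have hfr : ∀ x : S, spectralRadius ℂ (f x) = spectralRadius ℂ x := by
    intro x
    rw [← Subalgebra.spectralRadius_coe, hf, hT]
    simp only [spectralRadius, StarSubalgebra.spectrum_eq (S := S) (a := x) (hS := hS)]
  have hbij : Function.Bijective f := by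
    refine ⟨(injective_iff_map_eq_zero f).2 fun x hx ↦ ?_, ?_⟩
    · have h1 : T x = 0 := by rw [← hf, hx]; rfl
      have h2 := hbelow x x.2
      rw [h1, nnnorm_zero] at h2
      exact Subtype.ext (nnnorm_eq_zero.1 (le_antisymm h2 bot_le))
    · rintro ⟨b, hb⟩
      obtain ⟨x, hx, rfl⟩ := (hD b).1 hb
      exact ⟨⟨x, hx⟩, rfl⟩
  let e := LinearEquiv.ofBijective f hbij
  have hspec : ∀ z ∈ spectrum ℂ (⟨h, hh⟩ : S), z.im = 0 := by
    intro z hz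
    rw [StarSubalgebra.spectrum_eq (hS := hS)] at hz
    exact hsa.im_eq_zero_of_mem_spectrum hz
  have hsq : spectralRadius ℂ (f (⟨h, hh⟩ ^ 2) - f ⟨h, hh⟩ ^ 2) = 0 := by
    let _ : NormedCommRing S :=
      { (inferInstance : NormedRing S) with
        mul_comm := fun x y ↦ Subtype.ext (hcomm x x.2 y y.2) }
    let _ : NormedCommRing D := { (inferInstance : NormedRing D) with mul_comm := hDcomm }
    exact spectralRadius_map_sq_sub_sq (f := f) (g := e.symm.toLinearMap) (Subtype.ext hT_one)
      hfr e.symm_apply_apply e.apply_symm_apply hspec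
  obtain ⟨y, hy⟩ := hbij.2 (f (⟨h, hh⟩ ^ 2) - f ⟨h, hh⟩ ^ 2)
  rw [← hy, ← Subalgebra.spectralRadius_coe, hf, hnorm y y.2] at hsq
  have hy0 : y = 0 := Subtype.ext (nnnorm_eq_zero.1 (by exact_mod_cast hsq))
  rw [hy0, map_zero, eq_comm, sub_eq_zero] at hy
  have := congrArg (Subtype.val) hy
  simpa [hf, sq] using this

end Local

/-! ### Jordan isomorphisms -/

section Jordan

variable {A B : Type*}

theorem map_jordan_of_map_mul_self [CStarAlgebra A] [Ring B] [Algebra ℂ B] {T : A →ₗ[ℂ] B}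
    (h : ∀ a : A, IsSelfAdjoint a → T (a * a) = T a * T a) (a b : A) :
    T (a * b + b * a) = T a * T b + T b * T a := by
  have hsa : ∀ a b : A, IsSelfAdjoint a → IsSelfAdjoint b →
      T (a * b + b * a) = T a * T b + T b * T a := by
    intro a b ha hb
    have h1 := h (a + b) (ha.add hb)
    have e1 : (a + b) * (a + b) = a * a + b * b + (a * b + b * a) := by noncomm_ring
    rw [e1, map_add, map_add, h a ha, h b hb, map_add T (a * b), map_add T a] at h1
    have e2 : (T a + T b) * (T a + T b)
        = T a * T a + T b * T b + (T a * T b + T b * T a) := by noncomm_ring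
    rw [e2] at h1
    rw [map_add]
    exact add_left_cancel h1
  have hright : ∀ a b : A, IsSelfAdjoint a → T (a * b + b * a) = T a * T b + T b * T a := by
    intro a b ha
    obtain ⟨x, y, hx, hy, rfl⟩ : ∃ x y : A, IsSelfAdjoint x ∧ IsSelfAdjoint y ∧
        b = x + Complex.I • y :=
      ⟨_, _, (realPart b).2, (imaginaryPart b).2, (realPart_add_I_smul_imaginaryPart b).symm⟩
    have e : a * (x + Complex.I • y) + (x + Complex.I • y) * a
        = (a * x + x * a) + Complex.I • (a * y + y * a) := by
      simp only [mul_add, add_mul, mul_smul_comm, smul_mul_assoc, smul_add]; abel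
    rw [e, map_add, map_smul, hsa a x ha hx, hsa a y ha hy, map_add, map_smul]
    simp only [mul_add, add_mul, mul_smul_comm, smul_mul_assoc, smul_add]; abel
  obtain ⟨x, y, hx, hy, rfl⟩ : ∃ x y : A, IsSelfAdjoint x ∧ IsSelfAdjoint y ∧
      a = x + Complex.I • y :=
    ⟨_, _, (realPart a).2, (imaginaryPart a).2, (realPart_add_I_smul_imaginaryPart a).symm⟩
  have e : (x + Complex.I • y) * b + b * (x + Complex.I • y)
      = (x * b + b * x) + Complex.I • (y * b + b * y) := by
    simp only [mul_add, add_mul, mul_smul_comm, smul_mul_assoc, smul_add]; abel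
  rw [e, map_add, map_smul, hright x b hx, hright y b hy, map_add, map_smul]
  simp only [mul_add, add_mul, mul_smul_comm, smul_mul_assoc, smul_add]; abel

/-- The property of C⋆-algebras (a form of semiprimeness) behind the commutativity preservation
of Jordan isomorphisms. -/
theorem eq_zero_of_forall_jordan_sq_eq_zero [CStarAlgebra A] {c : A} (hc : c * c = 0)
    (h : ∀ d : A, (c * d + d * c) * (c * d + d * c) = 0) : c = 0 := by
  have sq_zero : ∀ e : A, IsSelfAdjoint e → e * e = 0 → e = 0 := by
    intro e he h0
    rw [← CStarRing.star_mul_self_eq_zero_iff, he.star_eq, h0]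
  have h1 : c * star c + star c * c = 0 :=
    sq_zero _ ((IsSelfAdjoint.mul_star_self c).add (IsSelfAdjoint.star_mul_self c)) (h (star c))
  have h2 : star c * c * (star c * c) = 0 := by
    calc star c * c * (star c * c) = star c * (c * star c) * c := by noncomm_ring
      _ = star c * (-(star c * c)) * c := by rw [eq_neg_of_add_eq_zero_left h1]
      _ = -(star c * star c * (c * c)) := by noncomm_ring
      _ = 0 := by rw [hc, mul_zero, neg_zero]
  exact (CStarRing.star_mul_self_eq_zero_iff c).1 (sq_zero _ (IsSelfAdjoint.star_mul_self c) h2)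

variable [CStarAlgebra A] [Ring B] [Algebra ℂ B] {T : A →ₗ[ℂ] B}

theorem IsJordanIsomorphism.map_mul_self (hT : IsJordanIsomorphism T) (a : A) :
    T (a * a) = T a * T a := by
  have h := hT.map_jordan a a
  rw [← two_smul ℂ, ← two_smul ℂ, map_smul] at h
  exact smul_right_injective B (two_ne_zero (α := ℂ)) h

/-- The double commutator is a Jordan polynomial, hence is preserved by Jordan isomorphisms; so
the images of commuting elements have a central commutator. -/
theorem IsJordanIsomorphism.commute_commutator (hT : IsJordanIsomorphism T) {a b : A}
    (hab : a * b = b * a) (w : B) :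
    (T a * T b - T b * T a) * w = w * (T a * T b - T b * T a) := by
  obtain ⟨c, rfl⟩ := hT.bijective.2 w
  have e : a * (b * c + c * b) + (b * c + c * b) * a = b * (a * c + c * a) + (a * c + c * a) * b := by
    have : a * (b * c + c * b) + (b * c + c * b) * a - (b * (a * c + c * a) + (a * c + c * a) * b)
        = (a * b - b * a) * c - c * (a * b - b * a) := by noncomm_ring
    rw [hab, sub_self, zero_mul, mul_zero, sub_self] at this
    exact sub_eq_zero.1 this
  have e' := congrArg T e
  simp only [hT.map_jordan] at e'
  rw [← sub_eq_zero] at e' ⊢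
  rw [← e']
  noncomm_ring

theorem IsJordanIsomorphism.commute (hT : IsJordanIsomorphism T) {a b : A}
    (hab : a * b = b * a) : T a * T b = T b * T a := by
  set x := T a with hx
  set y := T b with hy
  have hz : ∀ w, (x * y - y * x) * w = w * (x * y - y * x) := hT.commute_commutator hab
  have hz' : ∀ w, (x * (y * y) - y * y * x) * w = w * (x * (y * y) - y * y * x) := by
    rw [hy, ← hT.map_mul_self b]
    exact hT.commute_commutator (by rw [← mul_assoc, hab, mul_assoc, hab, mul_assoc])
  -- The commutators `z = [x, y]` and `[x, y²] = 2zy` are central, so `0 = [x, zy] = z²`.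
  set z := x * y - y * x with hzdef
  have h2 : x * (y * y) - y * y * x = (2 : ℂ) • (z * y) := by
    have : x * (y * y) - y * y * x = z * y + y * z := by rw [hzdef]; noncomm_ring
    rw [this, ← hz y, two_smul]
  have hzz : z * z = 0 := by
    have h3 := hz' x
    rw [h2, smul_mul_assoc, mul_smul_comm] at h3
    have h4 : z * y * x = x * (z * y) := smul_right_injective B (two_ne_zero (α := ℂ)) h3
    calc z * z = z * x * y - z * y * x := by conv_lhs => { rhs; rw [hzdef] }; noncomm_ring
      _ = 0 := by rw [h4, hz x]; noncomm_ring
  obtain ⟨c, hc⟩ := hT.bijective.2 z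
  have hc0 : c = 0 := by
    refine eq_zero_of_forall_jordan_sq_eq_zero ?_ fun d ↦ ?_
    · apply hT.bijective.1
      rw [hT.map_mul_self, hc, hzz, map_zero]
    -- `T (c * d + d * c) = 2 z (T d)` squares to zero because `z` is central.
    · apply hT.bijective.1
      rw [hT.map_mul_self, hT.map_jordan, hc, map_zero, ← hz (T d)]
      calc (z * T d + z * T d) * (z * T d + z * T d)
          = 4 * (z * (T d * z) * T d) := by noncomm_ring
        _ = 4 * (z * z * T d * T d) := by rw [← hz]; noncomm_ring
        _ = 0 := by rw [hzz]; simp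
  rw [hc0, map_zero] at hc
  exact sub_eq_zero.1 hc.symm

theorem IsJordanIsomorphism.map_mul_of_commute (hT : IsJordanIsomorphism T) {a b : A}
    (hab : a * b = b * a) : T (a * b) = T a * T b := by
  have h := hT.map_jordan a b
  rw [← hab, ← hT.commute hab, ← two_smul ℂ, ← two_smul ℂ, map_smul] at h
  exact smul_right_injective B (two_ne_zero (α := ℂ)) h

theorem IsJordanIsomorphism.isSubalgebra_image (hT : IsJordanIsomorphism T) (A₀ : Subalgebra ℂ A)
    (hA₀ : ∀ x ∈ A₀, ∀ y ∈ A₀, x * y = y * x) : IsSubalgebra (T '' (A₀ : Set A)) := by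
  refine ⟨{ (Subalgebra.toSubmodule A₀).map T with
    mul_mem' := ?_ }, rfl⟩
  rintro _ _ ⟨x, hx, rfl⟩ ⟨y, hy, rfl⟩
  exact ⟨x * y, A₀.mul_mem hx hy, hT.map_mul_of_commute (hA₀ x hx y hy)⟩

end Jordan

/-! ### The bicommutant and the generated C⋆-algebra of a self-adjoint element -/

section Bicommutant

variable {A : Type*}

theorem self_mem_bicommutant [Ring A] [Algebra ℂ A] (a : A) : a ∈ bicommutant a :=
  fun _ hx ↦ (hx a rfl).symm

theorem bicommutant_mul_comm [Ring A] [Algebra ℂ A] (a : A) :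
    ∀ x ∈ bicommutant a, ∀ y ∈ bicommutant a, x * y = y * x := by
  intro x hx _ hy
  refine hy x ?_
  rintro _ rfl
  exact hx _ fun _ h ↦ by rw [h]

theorem isClosed_bicommutant [CStarAlgebra A] (a : A) : IsClosed (bicommutant a : Set A) :=
  Set.isClosed_centralizer _

theorem star_mem_bicommutant [CStarAlgebra A] {a : A} (ha : IsSelfAdjoint a) {x : A}
    (hx : x ∈ bicommutant a) : star x ∈ bicommutant a := by
  intro y hy
  have hy' : star y ∈ Subalgebra.centralizer ℂ ({a} : Set A) := by
    rintro _ rfl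
    have := congrArg star (hy _ rfl)
    rw [star_mul, star_mul, ha.star_eq] at this
    exact this.symm
  have := congrArg star (hx _ hy')
  rw [star_mul, star_mul, star_star] at this
  exact this.symm

end Bicommutant

/-! ### The equivalence -/

theorem proposition3p1 {A B : Type*} [CStarAlgebra A]
    [NormedRing B] [NormedAlgebra ℂ B] [CompleteSpace B]
    (T : A →ₗ[ℂ] B) (hT_one : T 1 = 1) (hT_surj : Function.Surjective T)
    (hT : IsSpectralIsometry T) :
    List.TFAE
      [ IsJordanIsomorphism T,
        ∀ A₀ : Subalgebra ℂ A, (∀ x ∈ A₀, ∀ y ∈ A₀, x * y = y * x) →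
          IsSubalgebra (T '' (A₀ : Set A)),
        ∀ a : A, IsSelfAdjoint a → IsSubalgebra (T '' (bicommutant a : Set A)),
        ∀ a : A, IsSelfAdjoint a → IsSubalgebra (T '' (StarAlgebra.elemental ℂ a : Set A)) ] := by
  have hcont := hT.continuous hT_surj
  have elemental_comm : ∀ a : A, IsSelfAdjoint a → ∀ x ∈ StarAlgebra.elemental ℂ a,
      ∀ y ∈ StarAlgebra.elemental ℂ a, x * y = y * x := by
    intro a ha x hx y hy
    have : IsStarNormal a := ha.isStarNormal
    exact congrArg Subtype.val
      (mul_comm (⟨x, hx⟩ : StarAlgebra.elemental ℂ a) (⟨y, hy⟩ : StarAlgebra.elemental ℂ a))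
  tfae_have 1 → 2 := fun h A₀ hA₀ ↦ h.isSubalgebra_image A₀ hA₀
  tfae_have 2 → 3 := fun h a _ ↦ h _ (bicommutant_mul_comm a)
  tfae_have 2 → 4 := fun h a ha ↦
    h (StarAlgebra.elemental ℂ a).toSubalgebra (elemental_comm a ha)
  tfae_have 3 → 1 := fun h ↦
    { bijective := ⟨hT.injective, hT_surj⟩
      map_jordan := map_jordan_of_map_mul_self fun a ha ↦
        hT.map_mul_self hT_one hcont
          { bicommutant a with star_mem' := star_mem_bicommutant ha } (isClosed_bicommutant a)
          (bicommutant_mul_comm a) (h a ha) (self_mem_bicommutant a) ha }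
  tfae_have 4 → 1 := fun h ↦
    { bijective := ⟨hT.injective, hT_surj⟩
      map_jordan := map_jordan_of_map_mul_self fun a ha ↦
        hT.map_mul_self hT_one hcont (StarAlgebra.elemental ℂ a)
          (StarAlgebra.elemental.isClosed ℂ a) (elemental_comm a ha) (h a ha)
          (StarAlgebra.elemental.self_mem ℂ a) ha }
  tfae_finish
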